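/- **Setting.** A Markov decision process (MDP) has a countable set of states, partitioned into controlled and random states, a transition relation $\to$ in which every state has a successor, for every random state a probability distribution over its successors, and a real reward $r(x,y)$ for every transition $x\to y$. A strategy assigns to every partial run ending in a controlled state a distribution over the successors of that state (depending on the whole history, in general); it is deterministic (HD) if all these distributions are Dirac. A strategy $\sigma$ and an initial state $x_0$ induce a probability measure $\mathcal P_{x_0,\sigma}$ on the infinite runs $x_0x_1x_2\cdots$. The objective $PP_{\liminf\ge 0}$ is the set of runs with $\liminf_{n} r(x_n,x_{n+1})\ge 0$. The value of $x_0$ is $\sup_\sigma \mathcal P_{x_0,\sigma}(PP_{\liminf\ge 0})$; $\sigma$ is $\varepsilon$-optimal from $x_0$ if it attains at least the value minus $\varepsilon$, optimal if it is $0$-optimal, and almost-surely winning if it is optimal and the value is $1$. A strategy uses memory $\mathsf M$ if it is induced by an initial mode $\mathsf m_0\in\mathsf M$ and a function $\tau$ that assigns to each pair (mode, state) a distribution over pairs (new mode, next state), supported on successors for controlled states and with next-state marginal given by the MDP for random states: after a history, the strategy plays according to $\tau$, averaged over the distribution of the current mode conditioned on the history. It is a finite-memory randomized (FR) strategy if $\mathsf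 M$ can be chosen finite. It uses finite memory plus a reward counter if $\mathsf M$ can be chosen as a finite set times a counter that always contains the sum of all transition rewards seen so far. **The MDP $\mathcal M$.** The states are $s$, $t$ (controlled) and $r_1,r_2,\dots$ (random). The transitions are $s\to r_i$ for all $i\ge1$, $r_i\to t$ with probability $2^{-i}$, $r_i\to s$ with probability $1-2^{-i}$, and $t\to s$. The transitions $r_i\to t$ have reward $-1$, the transition $t\to s$ has reward $+1$, and all other transitions have reward $0$. **Theorem.** The MDP $\mathcal M$ is infinitely branching, the reward is implicit in the state (the total reward of a partial run from $s$ depends only on its last state), and 1. every FR strategy $\sigma$ satisfies $\mathcal P_{s,\sigma}(PP_{\liminf\ge0})=0$; 2. there is an HD strategy $\sigma$ with $\mathcal P_{s,\sigma}(PP_{\liminf\ge0})=1$. Hence the value of $s$ is $1$, and optimal (and even almost-surely winning) strategies, as well as $\varepsilon$-optimal strategies for $0\le\varepsilon<1$, for $PP_{\liminf\ge0}$ from $s$ require infinite memory beyond a reward counter: no such strategy is an FR strategy, and none uses only finite memory plus a reward counter. -/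

import Mathlib

open MeasureTheory ProbabilityTheory Filter
open scoped ENNReal NNReal

/-- A Markov decision process with state set `S`, controlled states `controlled` (all other states
are random), transition relation `trans`, probability function `prob` on the random states and
transition rewards `reward`. (Only the rewards of transitions in `trans` matter.) -/
structure MDP (S : Type*) where
  controlled : Set S
  trans : S → S → Prop
  exists_succ : ∀ s, ∃ s', trans s s'
  prob : (s : S) → s ∉ controlled → PMF S
  prob_support : ∀ (s : S) (hs : s ∉ controlled), ∀ s' ∈ (prob s hs).support, trans s s'
  reward : S → S → ℝ

namespace MDP

variable {S : Type*}

/-- Every state has finitely many successors. -/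
def FinitelyBranching (M : MDP S) : Prop := ∀ s, {s' | M.trans s s'}.Finite

/-- Infinitely branching means: not finitely branching. -/
def InfinitelyBranching (M : MDP S) : Prop := ¬ M.FinitelyBranching

/-- `w 0, …, w n` is a partial run: consecutive states are joined by transitions. -/
def IsPartialRun (M : MDP S) (w : ℕ → S) (n : ℕ) : Prop :=
  ∀ i < n, M.trans (w i) (w (i + 1))

/-- The sum of the transition rewards along `w 0, …, w n`. -/
def totalReward (M : MDP S) (w : ℕ → S) (n : ℕ) : ℝ :=
  ∑ i ∈ Finset.range n, M.reward (w i) (w (i + 1))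

/-- The reward is implicit in the state (from the initial state `s₀`): the total reward collected
by a partial run from `s₀` is a function of the state in which the partial run ends. -/
def RewardImplicit (M : MDP S) (s₀ : S) : Prop :=
  ∃ level : S → ℝ, ∀ (w : ℕ → S) (n : ℕ), w 0 = s₀ → M.IsPartialRun w n →
    M.totalReward w n = level (w n)

/-- A (history-dependent, randomized) strategy. The history `s₀ … sₙ` is given as a function on
`{0, …, n}`. Only the values at partial runs ending in a controlled state matter, and there the
distribution is over the successors of the last state. -/
structure Strategy (M : MDP S) where
  choice : (n : ℕ) → (Finset.Iic n → S) → PMF S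
  choice_support : ∀ (w : ℕ → S) (n : ℕ), M.IsPartialRun w n → w n ∈ M.controlled →
    ∀ s' ∈ (choice n (Preorder.frestrictLe n w)).support, M.trans (w n) s'

/-- The strategy picks a Dirac distribution at every partial run ending in a controlled state. -/
def Strategy.IsDeterministic {M : MDP S} (σ : M.Strategy) : Prop :=
  ∀ (w : ℕ → S) (n : ℕ), M.IsPartialRun w n → w n ∈ M.controlled →
    ∃ s', σ.choice n (Preorder.frestrictLe n w) = PMF.pure s'

open Classical in
/-- The distribution of the next state after the history `h`: given by the strategy if the last
state of `h` is controlled, and by the probability function of the MDP if it is random. -/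
noncomputable def Strategy.next {M : MDP S} (σ : M.Strategy) (n : ℕ) (h : Finset.Iic n → S) :
    PMF S :=
  if hs : h ⟨n, Finset.mem_Iic.2 le_rfl⟩ ∈ M.controlled then σ.choice n h
  else M.prob (h ⟨n, Finset.mem_Iic.2 le_rfl⟩) hs

section Measure

variable [Countable S] [MeasurableSpace S] [DiscreteMeasurableSpace S]

/-- `Strategy.next` as a kernel from histories of length `n + 1` to states. -/
noncomputable def Strategy.kernel {M : MDP S} (σ : M.Strategy) (n : ℕ) :
    Kernel (Finset.Iic n → S) S where
  toFun h := (σ.next n h).toMeasure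
  measurable' := measurable_of_countable _

instance {M : MDP S} (σ : M.Strategy) (n : ℕ) : IsMarkovKernel (σ.kernel n) :=
  ⟨fun h => PMF.toMeasure.isProbabilityMeasure (σ.next n h)⟩

/-- The probability measure on the infinite sequences of states induced by the initial state `s₀`
and the strategy `σ`, for the product σ-algebra (`S` is discrete): the cylinder of `s₀ … sₙ` has
probability `∏ i < n, σ.next i (s₀ … sᵢ) sᵢ₊₁`. -/
noncomputable def runMeasure (M : MDP S) (s₀ : S) (σ : M.Strategy) : Measure (ℕ → S) :=
  Kernel.traj (X := fun _ => S) σ.kernel 0 (fun _ => s₀)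

/-- The value of `s₀` for the objective `φ`. -/
noncomputable def value (M : MDP S) (φ : Set (ℕ → S)) (s₀ : S) : ℝ≥0∞ :=
  ⨆ σ : M.Strategy, M.runMeasure s₀ σ φ

/-- `σ` attains at least the value minus `ε` (used for `0 ≤ ε`). -/
def IsEpsOptimal (M : MDP S) (φ : Set (ℕ → S)) (s₀ : S) (ε : ℝ) (σ : M.Strategy) : Prop :=
  M.value φ s₀ - ENNReal.ofReal ε ≤ M.runMeasure s₀ σ φ

/-- `σ` attains the value. -/
def IsOptimal (M : MDP S) (φ : Set (ℕ → S)) (s₀ : S) (σ : M.Strategy) : Prop :=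
  M.IsEpsOptimal φ s₀ 0 σ

/-- `σ` is optimal and the value is `1`. -/
def IsAlmostSurelyWinning (M : MDP S) (φ : Set (ℕ → S)) (s₀ : S) (σ : M.Strategy) : Prop :=
  M.IsOptimal φ s₀ σ ∧ M.value φ s₀ = 1

end Measure

/-- The objective that the `lim inf` of the point payoffs (the transition rewards) is `≥ 0`; the
`lim inf` is taken in the extended reals. -/
def pointPayoff (M : MDP S) : Set (ℕ → S) :=
  {w | 0 ≤ liminf (fun n => ((M.reward (w n) (w (n + 1)) : ℝ) : EReal)) atTop}

/-- A randomized memory-based update function `τ` with set `Mem` of memory modes. In a random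
state the memory update may be correlated with the successor, but the successor has the law
prescribed by the MDP. -/
structure MemoryUpdate (M : MDP S) (Mem : Type*) where
  τ : Mem → S → PMF (Mem × S)
  controlled_support : ∀ (m : Mem), ∀ s ∈ M.controlled, ∀ p ∈ (τ m s).support, M.trans s p.2
  random_marginal : ∀ (m : Mem) (s : S) (hs : s ∉ M.controlled) (s' : S),
    ∑' m', τ m s (m', s') = M.prob s hs s'

namespace MemoryUpdate

variable {M : MDP S} {Mem : Type*}

open Classical in
/-- In the Markov chain on `Mem × S` given by `τ` and started in `(m₀, w 0)`: the probability that
the first `n` steps go through some `(m₀, w 0), (m₁, w 1), …, (mₙ, w n)` with `mₙ = m`. -/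
noncomputable def weight (u : M.MemoryUpdate Mem) (m₀ : Mem) (w : ℕ → S) : ℕ → Mem → ℝ≥0∞
  | 0, m => if m = m₀ then 1 else 0
  | n + 1, m' => ∑' m, weight u m₀ w n m * u.τ m (w n) (m', w (n + 1))

/-- The distribution of the current memory mode, conditioned on the history `w 0, …, w n`. -/
noncomputable def belief (u : M.MemoryUpdate Mem) (m₀ : Mem) (w : ℕ → S) (n : ℕ) (m : Mem) :
    ℝ≥0∞ :=
  u.weight m₀ w n m / ∑' m', u.weight m₀ w n m'

/-- `σ` is the strategy from the initial state `s₀` induced by the update function and the initial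
mode `m₀`. At histories of probability zero, where the conditional distribution of the memory mode
is undefined, `σ` is arbitrary. -/
def Induces (u : M.MemoryUpdate Mem) (m₀ : Mem) (s₀ : S) (σ : M.Strategy) : Prop :=
  ∀ (w : ℕ → S) (n : ℕ), w 0 = s₀ → M.IsPartialRun w n → w n ∈ M.controlled →
    ∑' m, u.weight m₀ w n m ≠ 0 →
    ∀ s', σ.choice n (Preorder.frestrictLe n w) s' =
      ∑' m, ∑' m', u.belief m₀ w n m * u.τ m (w n) (m', s')

end MemoryUpdate

/-- `σ` is a finite-memory randomized (FR) strategy from `s₀`. -/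
def Strategy.IsFiniteMemory {M : MDP S} (σ : M.Strategy) (s₀ : S) : Prop :=
  ∃ (Mem : Type) (_ : Finite Mem) (u : M.MemoryUpdate Mem) (m₀ : Mem), u.Induces m₀ s₀ σ

/-- `σ` is a randomized strategy from `s₀` using finite memory plus a reward counter: a memory
mode is a pair of an element of a finite set and a real number, which starts at `0` and to which
every step adds the reward of the transition taken. -/
def Strategy.IsFiniteMemoryRewardCounter {M : MDP S} (σ : M.Strategy) (s₀ : S) : Prop :=
  ∃ (Mem : Type) (_ : Finite Mem) (u : M.MemoryUpdate (Mem × ℝ)) (m₀ : Mem),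
    (∀ (m : Mem) (x : ℝ) (s : S) (m' : Mem) (x' : ℝ) (s' : S),
      ((m', x'), s') ∈ (u.τ (m, x) s).support → x' = x + M.reward s s') ∧
    u.Induces (m₀, 0) s₀ σ

end MDP

/-- The states of the example: the controlled states `s` and `t`, and the random states
`r₁, r₂, …`, where `r i` stands for `rᵢ₊₁`. -/
inductive ExState where
  | s : ExState
  | t : ExState
  | r (i : ℕ) : ExState

namespace ExState

/-- An injective coding of the states by natural numbers. -/
def code : ExState → ℕ
  | s => 0
  | t => 1
  | r i => i + 2

theorem code_injective : Function.Injective code := by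
  intro a b h
  cases a <;> cases b <;> simp [code] at h ⊢
  exact h

instance : Countable ExState := code_injective.countable

instance : MeasurableSpace ExState := ⊤

instance : DiscreteMeasurableSpace ExState := ⟨fun _ => trivial⟩

/-- `s → rᵢ`, `rᵢ → t`, `rᵢ → s` and `t → s`. -/
inductive Trans : ExState → ExState → Prop
  | s_r (i : ℕ) : Trans s (r i)
  | r_t (i : ℕ) : Trans (r i) t
  | r_s (i : ℕ) : Trans (r i) s
  | t_s : Trans t s

/-- The transitions into `t` have reward `-1`, the one from `t` to `s` has reward `1`, and all
others have reward `0`. -/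
def rew : ExState → ExState → ℝ
  | r _, t => -1
  | t, s => 1
  | _, _ => 0

/-- The distribution in the random state `r i` (that is, `rᵢ₊₁`): the next state is `t` with
probability `1 / 2 ^ (i + 1)` and `s` with probability `1 - 1 / 2 ^ (i + 1)`. -/
noncomputable def leaveFun (i : ℕ) : ExState → ℝ≥0∞
  | s => 1 - 2⁻¹ ^ (i + 1)
  | t => 2⁻¹ ^ (i + 1)
  | r _ => 0

theorem leaveFun_sum (i : ℕ) : leaveFun i s + leaveFun i t = 1 :=
  tsub_add_cancel_of_le (pow_le_one₀ zero_le (by simp))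

open Classical in
/-- `leaveFun` as a probability mass function. -/
noncomputable def leave (i : ℕ) : PMF ExState :=
  PMF.ofFinset (leaveFun i) {s, t}
    (by rw [Finset.sum_pair (by simp)]; exact leaveFun_sum i)
    (by rintro (_ | _ | j) h <;> simp [leaveFun] at h ⊢)

end ExState

/-- The infinitely branching example MDP. -/
noncomputable def exMDP : MDP ExState where
  controlled := {ExState.s, ExState.t}
  trans := ExState.Trans
  exists_succ a := by
    cases a with
    | s => exact ⟨_, .s_r 0⟩
    | t => exact ⟨_, .t_s⟩
    | r i => exact ⟨_, .r_s i⟩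
  prob
    | .r i, _ => ExState.leave i
    | .s, h => absurd (by simp) h
    | .t, h => absurd (by simp) h
  prob_support := by
    rintro (_ | _ | i) hs s' h
    · simp at hs
    · simp at hs
    · cases s' with
      | s => exact .r_s i
      | t => exact .r_t i
      | r j => simp [ExState.leave, ExState.leaveFun] at h
  reward := ExState.rew

/-! Only the transitions into `t` have negative reward, and `t` is left at once, so a run wins iff
it visits `t` finitely often (`mem_pointPayoff_iff`). Finite memory: in `s`, each mode `m` has a
positive probability `q m` of being in `t` two steps later, because every successor of `s` is some
`r i`. Over finitely many modes these have a positive minimum `δ`, and averaging over the belief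
keeps the bound. So each visit to `s` leads to `t` two steps later with conditional probability at
least `δ`, while a run that avoids `t` from some time on is eventually in `s` at every second step;
this has probability at most `(1 - δ) ^ j` for all `j` (`measure_forall_eq_s`,
`measure_pointPayoff_eq_zero`). A reward counter does not help: in `s` it always reads `0`, so still
only finitely many modes occur there. Winning: moving to `r n` at time `n` makes the probabilities
of being in `t` summable, and Borel–Cantelli applies. -/

namespace MDP

/-! ### One-step identities for the run measure. -/

section RunMeasure

variable {S : Type*} [Countable S] [MeasurableSpace S] [DiscreteMeasurableSpace S]

instance (M : MDP S) (s₀ : S) (σ : M.Strategy) : IsProbabilityMeasure (M.runMeasure s₀ σ) := by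
  unfold runMeasure
  infer_instance

/-- The joint law of history and next state is the law of the history composed with the step kernel.
The probability estimates below come from choices of `f`. -/
theorem lintegral_runMeasure_succ {M : MDP S} (s₀ : S) (σ : M.Strategy) (n : ℕ)
    (f : (Finset.Iic n → S) → S → ℝ≥0∞) :
    ∫⁻ w, f (Preorder.frestrictLe n w) (w (n + 1)) ∂M.runMeasure s₀ σ =
      ∫⁻ w, ∑' s', σ.next n (Preorder.frestrictLe n w) s' * f (Preorder.frestrictLe n w) s'
        ∂M.runMeasure s₀ σ := by
  have hf : Measurable (Function.uncurry f) := measurable_of_countable _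
  have hmap := Kernel.partialTraj_compProd_eq_map_traj (X := fun _ => S) (κ := σ.kernel)
    (a := 0) (b := n) (Nat.zero_le n) (x₀ := fun _ => s₀)
  have h₁ : ∫⁻ w, f (Preorder.frestrictLe n w) (w (n + 1)) ∂M.runMeasure s₀ σ =
      ∫⁻ p, Function.uncurry f p ∂((M.runMeasure s₀ σ).map
        (fun x => (Preorder.frestrictLe (π := fun _ => S) n x, x (n + 1)))) := by
    rw [lintegral_map hf (by fun_prop)]
    rfl
  rw [h₁, runMeasure, ← hmap, Measure.lintegral_compProd hf, ← Kernel.traj_map_frestrictLe_apply,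
    lintegral_map (measurable_of_countable _) (by fun_prop)]
  refine lintegral_congr fun w => ?_
  rw [lintegral_countable']
  refine tsum_congr fun s' => ?_
  change _ * (σ.next n _).toMeasure {s'} = _
  rw [PMF.toMeasure_apply_singleton _ _ (measurableSet_singleton _), mul_comm]
  rfl

theorem ae_runMeasure_zero {M : MDP S} (s₀ : S) (σ : M.Strategy) :
    ∀ᵐ w ∂M.runMeasure s₀ σ, w 0 = s₀ := by
  have h := Kernel.traj_map_frestrictLe_apply (X := fun _ => S) (κ := σ.kernel) 0 0 (fun _ => s₀)
  rw [Kernel.partialTraj_self, Kernel.id_apply] at h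
  have h₁ : ∀ᵐ x ∂((M.runMeasure s₀ σ).map (Preorder.frestrictLe (π := fun _ => S) 0)),
      x ⟨0, by simp⟩ = s₀ := by
    rw [runMeasure, h, ae_dirac_eq]
    rfl
  exact ae_of_ae_map (by fun_prop) h₁

/-- Lets pathwise arguments assume that every step has positive probability, hence that the run
follows transitions. -/
theorem ae_next_ne_zero {M : MDP S} (s₀ : S) (σ : M.Strategy) :
    ∀ᵐ w ∂M.runMeasure s₀ σ, ∀ n, σ.next n (Preorder.frestrictLe n w) (w (n + 1)) ≠ 0 := by
  classical
  refine ae_all_iff.2 fun n => ?_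
  have h := lintegral_runMeasure_succ s₀ σ n fun h s' => if σ.next n h s' = 0 then 1 else 0
  have hz : ∀ w : ℕ → S, ∑' s', σ.next n (Preorder.frestrictLe n w) s' *
      (if σ.next n (Preorder.frestrictLe n w) s' = 0 then 1 else 0) = 0 := by
    intro w
    simp
  simp only [hz, lintegral_zero] at h
  have hm : Measurable fun w : ℕ → S =>
      if σ.next n (Preorder.frestrictLe n w) (w (n + 1)) = 0 then (1 : ℝ≥0∞) else 0 :=
    (measurable_of_countable (fun p : (Finset.Iic n → S) × S =>
      if σ.next n p.1 p.2 = 0 then (1 : ℝ≥0∞) else 0)).comp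
      (f := fun w : ℕ → S => (Preorder.frestrictLe n w, w (n + 1))) (by fun_prop)
  filter_upwards [(lintegral_eq_zero_iff hm).1 h] with w hw h0
  simp [h0] at hw

end RunMeasure

variable {S : Type*} {M : MDP S}

theorem Strategy.next_of_mem (σ : M.Strategy) {n : ℕ} {w : ℕ → S} (h : w n ∈ M.controlled) :
    σ.next n (Preorder.frestrictLe n w) = σ.choice n (Preorder.frestrictLe n w) :=
  dif_pos h

theorem Strategy.next_of_notMem (σ : M.Strategy) {n : ℕ} {w : ℕ → S} (h : w n ∉ M.controlled) :
    σ.next n (Preorder.frestrictLe n w) = M.prob (w n) h :=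
  dif_neg h

theorem Strategy.trans_of_next_ne_zero (σ : M.Strategy) {n : ℕ} {w : ℕ → S}
    (hw : M.IsPartialRun w n) {s' : S} (h : σ.next n (Preorder.frestrictLe n w) s' ≠ 0) :
    M.trans (w n) s' := by
  by_cases hc : w n ∈ M.controlled
  · rw [σ.next_of_mem hc] at h
    exact σ.choice_support w n hw hc s' h
  · rw [σ.next_of_notMem hc] at h
    exact M.prob_support _ hc s' h

theorem Strategy.isPartialRun_of_next_ne_zero (σ : M.Strategy) {w : ℕ → S}
    (h : ∀ n, σ.next n (Preorder.frestrictLe n w) (w (n + 1)) ≠ 0) (n : ℕ) :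
    M.IsPartialRun w n := by
  induction n with
  | zero => exact fun i hi => absurd hi (Nat.not_lt_zero i)
  | succ n ih =>
    intro i hi
    rcases Nat.lt_succ_iff_lt_or_eq.1 hi with hi | rfl
    · exact ih i hi
    · exact σ.trans_of_next_ne_zero ih (h i)

/-! ### Weights and beliefs of memory modes. -/

namespace MemoryUpdate

variable {Mem : Type*}

theorem tsum_weight_succ (u : M.MemoryUpdate Mem) (m₀ : Mem) (w : ℕ → S) (n : ℕ) :
    ∑' m', u.weight m₀ w (n + 1) m' =
      ∑' m, u.weight m₀ w n m * ∑' m', u.τ m (w n) (m', w (n + 1)) := by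
  simp only [weight]
  rw [ENNReal.tsum_comm]
  simp only [ENNReal.tsum_mul_left]

theorem tsum_weight_le_one (u : M.MemoryUpdate Mem) (m₀ : Mem) (w : ℕ → S) (n : ℕ) :
    ∑' m, u.weight m₀ w n m ≤ 1 := by
  induction n with
  | zero => simp [weight]
  | succ n ih =>
    rw [tsum_weight_succ]
    refine le_trans (ENNReal.tsum_le_tsum fun m => ?_) ih
    refine mul_le_of_le_one_right zero_le ?_
    rw [← (u.τ m (w n)).tsum_coe]
    exact ENNReal.tsum_comp_le_tsum_of_injective
      (f := fun m' => (m', w (n + 1))) (fun _ _ h => congrArg Prod.fst h) _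

theorem tsum_belief (u : M.MemoryUpdate Mem) (m₀ : Mem) (w : ℕ → S) (n : ℕ)
    (h : ∑' m, u.weight m₀ w n m ≠ 0) : ∑' m, u.belief m₀ w n m = 1 := by
  simp only [belief, div_eq_mul_inv]
  rw [ENNReal.tsum_mul_right]
  exact ENNReal.mul_inv_cancel h
    (ne_top_of_le_ne_top ENNReal.one_ne_top (u.tsum_weight_le_one m₀ w n))

/-- `Induces` constrains `σ` only at histories of nonzero weight, so almost every run must be shown
to keep such weight. In a controlled state, a positive step probability is a belief average and
forces a positive term; in a random state the total weight is multiplied by the MDP's own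
probability. -/
theorem tsum_weight_succ_ne_zero {u : M.MemoryUpdate Mem} {m₀ : Mem} {s₀ : S} {σ : M.Strategy}
    (hu : u.Induces m₀ s₀ σ) {w : ℕ → S} {n : ℕ} (h0 : w 0 = s₀) (hw : M.IsPartialRun w n)
    (hn : ∑' m, u.weight m₀ w n m ≠ 0)
    (hnext : σ.next n (Preorder.frestrictLe n w) (w (n + 1)) ≠ 0) :
    ∑' m, u.weight m₀ w (n + 1) m ≠ 0 := by
  rw [tsum_weight_succ]
  by_cases hc : w n ∈ M.controlled
  · rw [σ.next_of_mem hc, hu w n h0 hw hc hn] at hnext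
    intro hz
    refine hnext (ENNReal.tsum_eq_zero.2 fun m => ?_)
    rw [ENNReal.tsum_mul_left]
    rcases mul_eq_zero.1 (ENNReal.tsum_eq_zero.1 hz m) with h | h
    · simp [belief, h]
    · rw [h, mul_zero]
  · rw [σ.next_of_notMem hc] at hnext
    simp only [u.random_marginal _ _ hc, ENNReal.tsum_mul_right]
    exact mul_ne_zero hn hnext

theorem tsum_weight_ne_zero {u : M.MemoryUpdate Mem} {m₀ : Mem} {s₀ : S} {σ : M.Strategy}
    (hu : u.Induces m₀ s₀ σ) {w : ℕ → S} (h0 : w 0 = s₀)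
    (hnext : ∀ n, σ.next n (Preorder.frestrictLe n w) (w (n + 1)) ≠ 0) (n : ℕ) :
    ∑' m, u.weight m₀ w n m ≠ 0 := by
  induction n with
  | zero => simp [weight]
  | succ n ih =>
    exact tsum_weight_succ_ne_zero hu h0 (σ.isPartialRun_of_next_ne_zero hnext n) ih (hnext n)

/-- If the second component of the memory counts the reward, it contains the total reward. -/
theorem eq_totalReward_of_weight_ne_zero {u : M.MemoryUpdate (Mem × ℝ)}
    (hu : ∀ (m : Mem) (x : ℝ) (s : S) (m' : Mem) (x' : ℝ) (s' : S),
      ((m', x'), s') ∈ (u.τ (m, x) s).support → x' = x + M.reward s s')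
    (m₀ : Mem) (w : ℕ → S) (n : ℕ) (p : Mem × ℝ) (hp : u.weight (m₀, 0) w n p ≠ 0) :
    p.2 = M.totalReward w n := by
  induction n generalizing p with
  | zero =>
    have : p = (m₀, 0) := by
      by_contra h
      simp [weight, h] at hp
    simp [this, totalReward]
  | succ n ih =>
    rw [weight, Ne, ENNReal.tsum_eq_zero, not_forall] at hp
    obtain ⟨q, hq⟩ := hp
    have h₁ := ih q (left_ne_zero_of_mul hq)
    have h₂ := hu q.1 q.2 (w n) p.1 p.2 (w (n + 1)) (right_ne_zero_of_mul hq)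
    rw [h₂, h₁, totalReward, totalReward, Finset.sum_range_succ]

end MemoryUpdate

end MDP

/-! ### Rewards and the objective in the example. -/

namespace ExState

/-- The probability that the next state is `t`, as a function of the current random state. -/
noncomputable def hit : ExState → ℝ≥0∞
  | r i => 2⁻¹ ^ (i + 1)
  | _ => 0

theorem leave_t (i : ℕ) : leave i t = 2⁻¹ ^ (i + 1) := rfl

/-- The total reward of a partial run from `s` that ends in the given state. -/
def level : ExState → ℝ
  | t => -1
  | _ => 0

end ExState

open ExState

theorem exMDP_infinitelyBranching : exMDP.InfinitelyBranching := by
  intro h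
  refine Set.infinite_range_of_injective (f := ExState.r) (fun _ _ h => by simpa using h)
    ((h s).subset ?_)
  rintro _ ⟨i, rfl⟩
  exact Trans.s_r i

theorem exMDP_totalReward (w : ℕ → ExState) (n : ℕ) (h0 : w 0 = s)
    (hw : exMDP.IsPartialRun w n) : exMDP.totalReward w n = level (w n) := by
  induction n with
  | zero => simp [MDP.totalReward, h0, level]
  | succ n ih =>
    rw [MDP.totalReward, Finset.sum_range_succ]
    change exMDP.totalReward w n + _ = _
    rw [ih fun i hi => hw i (hi.trans n.lt_succ_self)]
    have ht : Trans (w n) (w (n + 1)) := hw n n.lt_succ_self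
    change _ + rew _ _ = _
    revert ht
    generalize w n = a
    generalize w (n + 1) = b
    rintro (_ | _ | _ | _) <;> simp [level, rew]

theorem exMDP_rewardImplicit : exMDP.RewardImplicit s :=
  ⟨level, exMDP_totalReward⟩

theorem mem_pointPayoff_iff {w : ℕ → ExState} (hw : ∀ n, Trans (w n) (w (n + 1))) :
    w ∈ exMDP.pointPayoff ↔ ∀ᶠ n in atTop, w n ≠ t := by
  constructor
  · intro h
    by_contra hf
    have hf' : ∃ᶠ n in atTop, w n = t := by
      simpa only [not_eventually, not_not] using hf
    have hf'' : ∃ᶠ n in atTop, ((exMDP.reward (w n) (w (n + 1)) : ℝ) : EReal) ≤ (-1 : ℝ) := by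
      rw [frequently_atTop] at hf' ⊢
      intro a
      -- A visit at time `b ≥ 1` is preceded by the transition of reward `-1` at time `b - 1`; the
      -- shift by one excludes `b = 0`.
      obtain ⟨b, hb, hbt⟩ := hf' (a + 1)
      obtain ⟨c, rfl⟩ : ∃ c, b = c + 1 := ⟨b - 1, by lia⟩
      refine ⟨c, by lia, ?_⟩
      have h₁ := hw c
      rw [hbt] at h₁ ⊢
      revert h₁
      generalize w c = x
      rintro (_ | _)
      exact le_rfl
    have h₂ : (0 : EReal) ≤ ((-1 : ℝ) : EReal) := le_trans h (liminf_le_of_frequently_le' hf'')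
    have h₃ : (0 : ℝ) ≤ -1 := by exact_mod_cast h₂
    norm_num at h₃
  · intro h
    change 0 ≤ liminf (fun n => ((exMDP.reward (w n) (w (n + 1)) : ℝ) : EReal)) atTop
    refine le_liminf_of_le (h := ?_)
    rw [eventually_atTop] at h ⊢
    obtain ⟨a, ha⟩ := h
    refine ⟨a, fun b hb => ?_⟩
    have h₁ := hw b
    have h₂ := ha (b + 1) (by lia)
    have h₃ : (0 : ℝ) ≤ exMDP.reward (w b) (w (b + 1)) := by
      change 0 ≤ rew _ _
      revert h₁ h₂
      generalize w b = x
      generalize w (b + 1) = y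
      rintro (_ | _ | _ | _) <;> simp [rew]
    exact_mod_cast h₃

/-! ### A uniform two-step chance of reaching `t` implies almost sure failure. -/

theorem ae_trans (σ : exMDP.Strategy) :
    ∀ᵐ w ∂exMDP.runMeasure s σ, ∀ n, Trans (w n) (w (n + 1)) := by
  filter_upwards [MDP.ae_next_ne_zero s σ] with w hw n
  exact σ.isPartialRun_of_next_ne_zero hw (n + 1) n n.lt_succ_self

theorem next_of_eq_r (σ : exMDP.Strategy) {n i : ℕ} {w : ℕ → ExState} (h : w n = r i) :
    σ.next n (Preorder.frestrictLe n w) = leave i := by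
  have hn : w n ∉ exMDP.controlled := by rw [h]; simp [exMDP]
  rw [σ.next_of_notMem hn]
  revert hn
  rw [h]
  exact fun _ => rfl

theorem hit_le_next (σ : exMDP.Strategy) (n : ℕ) (w : ℕ → ExState) :
    hit (w n) ≤ σ.next n (Preorder.frestrictLe n w) t := by
  cases h : w n with
  | s => exact zero_le
  | t => exact zero_le
  | r i => rw [next_of_eq_r σ h, leave_t, hit]

theorem measurableSet_eq_t (n : ℕ) : MeasurableSet {w : ℕ → ExState | w n = t} :=
  (measurable_pi_apply n : Measurable fun w : ℕ → ExState => w n) (measurableSet_singleton t)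

/-- The one-step identity is used twice: at time `k` it turns the sum in `hδ` into the integral of
`hit (w (k + 1))`, and at time `k + 1` it turns `hit` into the event of being in `t`. -/
theorem mul_le_measure_inter_eq_t {σ : exMDP.Strategy} {δ : ℝ≥0∞}
    (hδ : ∀ᵐ w ∂exMDP.runMeasure s σ, ∀ k, w k = s →
      δ ≤ ∑' a, σ.next k (Preorder.frestrictLe k w) a * hit a)
    {k : ℕ} {B : Set (Finset.Iic k → ExState)} (hB : ∀ h ∈ B, h ⟨k, by simp⟩ = s) :
    δ * exMDP.runMeasure s σ (Preorder.frestrictLe k ⁻¹' B) ≤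
      exMDP.runMeasure s σ (Preorder.frestrictLe k ⁻¹' B ∩ {w | w (k + 2) = t}) := by
  classical
  have hBm : MeasurableSet B := (Set.to_countable B).measurableSet
  have hAm : MeasurableSet (Preorder.frestrictLe (π := fun _ => ExState) k ⁻¹' B) :=
    (by fun_prop : Measurable (Preorder.frestrictLe (π := fun _ : ℕ => ExState) k)) hBm
  have htm : MeasurableSet {w : ℕ → ExState | w (k + 2) = t} :=
    measurableSet_eq_t (k + 2)
  let b : (Finset.Iic k → ExState) → ℝ≥0∞ := B.indicator 1
  let g : ExState → ℝ≥0∞ := fun a => if a = t then 1 else 0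
  have h₂ := MDP.lintegral_runMeasure_succ s σ (k + 1)
    fun h a => b (Preorder.frestrictLe₂ (π := fun _ => ExState) k.le_succ h) * g a
  have h₁ := MDP.lintegral_runMeasure_succ s σ k fun h a => b h * hit a
  calc δ * exMDP.runMeasure s σ (Preorder.frestrictLe k ⁻¹' B)
      = ∫⁻ w, (Preorder.frestrictLe k ⁻¹' B).indicator (fun _ => δ) w ∂exMDP.runMeasure s σ := by
        rw [lintegral_indicator_const hAm]
    _ ≤ ∫⁻ w, ∑' a, σ.next k (Preorder.frestrictLe k w) a *
          (b (Preorder.frestrictLe k w) * hit a) ∂exMDP.runMeasure s σ := by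
        refine lintegral_mono_ae ?_
        filter_upwards [hδ] with w hw
        by_cases hwB : Preorder.frestrictLe k w ∈ B
        · simpa [Set.indicator, b, hwB] using hw k (hB _ hwB)
        · simp [Set.indicator, hwB]
    _ = ∫⁻ w, b (Preorder.frestrictLe k w) * hit (w (k + 1)) ∂exMDP.runMeasure s σ := h₁.symm
    _ ≤ ∫⁻ w, ∑' a, σ.next (k + 1) (Preorder.frestrictLe (k + 1) w) a *
          (b (Preorder.frestrictLe k w) * g a) ∂exMDP.runMeasure s σ := by
        refine lintegral_mono fun w => ?_
        refine le_trans ?_ (ENNReal.le_tsum t)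
        simp only [g, if_true, mul_one]
        rw [mul_comm]
        exact mul_le_mul_left (hit_le_next σ (k + 1) w) _
    _ = ∫⁻ w, b (Preorder.frestrictLe k w) * g (w (k + 1 + 1)) ∂exMDP.runMeasure s σ := h₂.symm
    _ = ∫⁻ w, (Preorder.frestrictLe k ⁻¹' B ∩ {w | w (k + 2) = t}).indicator 1 w
          ∂exMDP.runMeasure s σ := by
        refine lintegral_congr fun w => ?_
        by_cases hwB : Preorder.frestrictLe k w ∈ B <;> by_cases hwt : w (k + 2) = t <;>
          simp [Set.indicator, b, g, hwB, hwt]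
    _ = _ := lintegral_indicator_one (hAm.inter htm)

theorem measure_forall_eq_s {σ : exMDP.Strategy} {δ : ℝ≥0∞} (hδ0 : δ ≠ 0)
    (hδ : ∀ᵐ w ∂exMDP.runMeasure s σ, ∀ k, w k = s →
      δ ≤ ∑' a, σ.next k (Preorder.frestrictLe k w) a * hit a) (k : ℕ) :
    exMDP.runMeasure s σ {w | ∀ i, w (k + 2 * i) = s} = 0 := by
  let D : ℕ → Set (ℕ → ExState) := fun j => {w | ∀ i ≤ j, w (k + 2 * i) = s}
  have hstep : ∀ j, exMDP.runMeasure s σ (D (j + 1)) ≤ (1 - δ) * exMDP.runMeasure s σ (D j) := by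
    intro j
    let B : Set (Finset.Iic (k + 2 * j) → ExState) :=
      {h | ∀ i (hi : i ≤ j), h ⟨k + 2 * i, by simpa using hi⟩ = s}
    have hDB : D j = Preorder.frestrictLe (k + 2 * j) ⁻¹' B := rfl
    have h₁ := mul_le_measure_inter_eq_t hδ (B := B) fun h hh => hh j le_rfl
    rw [← hDB] at h₁
    have htm : MeasurableSet {w : ℕ → ExState | w (k + 2 * j + 2) = t} :=
      measurableSet_eq_t (k + 2 * j + 2)
    have h₂ := measure_inter_add_sdiff (μ := exMDP.runMeasure s σ) (D j) htm
    -- Being in `s` at time `k + 2 * (j + 1)` excludes `t`, which takes at least the fraction `δ` of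
    -- `D j`.
    have h₃ : D (j + 1) ⊆ D j \ {w : ℕ → ExState | w (k + 2 * j + 2) = t} := by
      intro w hw
      refine ⟨fun i hi => hw i (by lia), fun ht => ?_⟩
      have := hw (j + 1) le_rfl
      rw [show k + 2 * (j + 1) = k + 2 * j + 2 by ring, show w (k + 2 * j + 2) = t from ht] at this
      cases this
    rw [ENNReal.sub_mul fun _ _ => measure_ne_top _ _, one_mul]
    refine ENNReal.le_sub_of_add_le_right
      (ne_top_of_le_ne_top (measure_ne_top _ _) h₁) ?_
    calc _ ≤ exMDP.runMeasure s σ (D j \ {w : ℕ → ExState | w (k + 2 * j + 2) = t}) +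
          exMDP.runMeasure s σ (D j ∩ {w : ℕ → ExState | w (k + 2 * j + 2) = t}) :=
          add_le_add (measure_mono h₃) h₁
      _ = _ := by rw [add_comm, h₂]
  have hpow : ∀ j, exMDP.runMeasure s σ (D j) ≤ (1 - δ) ^ j := by
    intro j
    induction j with
    | zero => simpa using prob_le_one
    | succ j ih =>
      rw [pow_succ']
      exact (hstep j).trans (mul_le_mul_right ih _)
  have hlim := ENNReal.tendsto_pow_atTop_nhds_zero_of_lt_one
    (ENNReal.sub_lt_self ENNReal.one_ne_top one_ne_zero hδ0)
  refine le_antisymm (ge_of_tendsto' hlim fun j => ?_) zero_le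
  exact (measure_mono fun w hw i _ => (hw : ∀ i, w (k + 2 * i) = s) i).trans (hpow j)

/-- Without `t`, a run alternates between `s` and random states, so a winning run lies in one of the
countably many null sets of `measure_forall_eq_s`. -/
theorem measure_pointPayoff_eq_zero {σ : exMDP.Strategy} {δ : ℝ≥0∞} (hδ0 : δ ≠ 0)
    (hδ : ∀ᵐ w ∂exMDP.runMeasure s σ, ∀ k, w k = s →
      δ ≤ ∑' a, σ.next k (Preorder.frestrictLe k w) a * hit a) :
    exMDP.runMeasure s σ exMDP.pointPayoff = 0 := by
  have h : ∀ᵐ w ∂exMDP.runMeasure s σ, ∀ k, ¬ ∀ i, w (k + 2 * i) = s :=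
    ae_all_iff.2 fun k => by
      rw [ae_iff]
      simpa only [not_not] using measure_forall_eq_s hδ0 hδ k
  refine measure_eq_zero_iff_ae_notMem.2 ?_
  filter_upwards [h, ae_trans σ] with w hw ht hmem
  rw [mem_pointPayoff_iff ht, eventually_atTop] at hmem
  obtain ⟨N, hN⟩ := hmem
  have hs : ∀ n, N ≤ n → w n = s → ∀ i, w (n + 2 * i) = s := by
    intro n hn hns i
    induction i with
    | zero => exact hns
    | succ i ih =>
      have h₁ := ht (n + 2 * i)
      have h₂ := ht (n + 2 * i + 1)
      have h₃ := hN (n + 2 * i + 1 + 1) (by lia)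
      rw [show n + 2 * (i + 1) = n + 2 * i + 1 + 1 by ring]
      rw [ih] at h₁
      revert h₁ h₂ h₃
      generalize w (n + 2 * i + 1) = x
      generalize w (n + 2 * i + 1 + 1) = y
      rintro (_ | _) (_ | _) h₃
      · exact absurd rfl h₃
      · rfl
  cases hwN : w N with
  | s => exact hw N (hs N le_rfl hwN)
  | t => exact hN N le_rfl hwN
  | r i =>
    refine hw (N + 1) (hs (N + 1) (by lia) ?_)
    have h₁ := ht N
    have h₂ := hN (N + 1) (by lia)
    rw [hwN] at h₁
    revert h₁ h₂
    generalize w (N + 1) = y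
    rintro (_ | _) h₂
    · exact absurd rfl h₂
    · rfl

/-! ### Finite memory, with or without a reward counter. -/

/-- A strategy induced by a memory update function fails almost surely if only finitely many
memory modes are reachable in the state `s`. -/
theorem measure_pointPayoff_eq_zero_of_induces {Mem : Type} {u : exMDP.MemoryUpdate Mem} {m₀ : Mem}
    {σ : exMDP.Strategy} (hu : u.Induces m₀ s σ) (F : Finset Mem)
    (hF : ∀ w n, w 0 = s → exMDP.IsPartialRun w n → w n = s →
      ∀ m, u.weight m₀ w n m ≠ 0 → m ∈ F) :
    exMDP.runMeasure s σ exMDP.pointPayoff = 0 := by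
  -- The probability of being in `t` two steps after `s` in mode `m`.
  let q : Mem → ℝ≥0∞ := fun m => ∑' a, (∑' m', u.τ m s (m', a)) * hit a
  have hq : ∀ m, 0 < q m := by
    intro m
    obtain ⟨⟨m', a⟩, hp⟩ := (u.τ m s).support_nonempty
    have ha : Trans s a := u.controlled_support m s (by simp [exMDP]) _ hp
    obtain ⟨i⟩ := ha
    refine pos_iff_ne_zero.2 fun hz => ?_
    have h₁ := ENNReal.tsum_eq_zero.1 hz (r i)
    rcases mul_eq_zero.1 h₁ with h₂ | h₂
    · exact hp (ENNReal.tsum_eq_zero.1 h₂ m')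
    · simp [hit] at h₂
  refine measure_pointPayoff_eq_zero (δ := F.inf q)
    ((Finset.lt_inf_iff ENNReal.zero_lt_top).2 fun m _ => hq m).ne' ?_
  filter_upwards [MDP.ae_runMeasure_zero s σ, MDP.ae_next_ne_zero s σ] with w h0 hnext k hk
  have hrun := σ.isPartialRun_of_next_ne_zero hnext k
  have hc : w k ∈ exMDP.controlled := by rw [hk]; simp [exMDP]
  have hT := MDP.MemoryUpdate.tsum_weight_ne_zero hu h0 hnext k
  -- By Tonelli, the two-step probability under `σ` is the belief average of `q`. The belief has
  -- total mass `1` and lives on `F`, so the average is at least `F.inf q`.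
  have hsum : ∑' a, σ.next k (Preorder.frestrictLe k w) a * hit a =
      ∑' m, u.belief m₀ w k m * q m := by
    rw [σ.next_of_mem hc]
    simp only [hu w k h0 hrun hc hT, hk, q]
    simp only [ENNReal.tsum_mul_left, ← ENNReal.tsum_mul_right]
    rw [ENNReal.tsum_comm]
    simp only [← ENNReal.tsum_mul_left, ← ENNReal.tsum_mul_right, mul_assoc]
  rw [hsum]
  calc F.inf q = ∑' m, u.belief m₀ w k m * F.inf q := by
        rw [ENNReal.tsum_mul_right, u.tsum_belief m₀ w k hT, one_mul]
    _ ≤ _ := by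
        refine ENNReal.tsum_le_tsum fun m => ?_
        by_cases hm : u.weight m₀ w k m = 0
        · simp [MDP.MemoryUpdate.belief, hm]
        · exact mul_le_mul_right (Finset.inf_le (hF w k h0 hrun hk m hm)) _

theorem measure_pointPayoff_of_isFiniteMemory {σ : exMDP.Strategy} (hσ : σ.IsFiniteMemory s) :
    exMDP.runMeasure s σ exMDP.pointPayoff = 0 := by
  obtain ⟨Mem, _, u, m₀, hu⟩ := hσ
  have := Fintype.ofFinite Mem
  exact measure_pointPayoff_eq_zero_of_induces hu Finset.univ
    fun _ _ _ _ _ m _ => Finset.mem_univ m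

/-- The counter holds the total reward, which is `level s = 0` whenever the run is in `s`; the
reachable modes there form a finite set. -/
theorem measure_pointPayoff_of_isFiniteMemoryRewardCounter {σ : exMDP.Strategy}
    (hσ : σ.IsFiniteMemoryRewardCounter s) :
    exMDP.runMeasure s σ exMDP.pointPayoff = 0 := by
  obtain ⟨Mem, _, u, m₀, hc, hu⟩ := hσ
  have := Fintype.ofFinite Mem
  refine measure_pointPayoff_eq_zero_of_induces hu (Finset.univ ×ˢ {0})
    fun w n h0 hw hn m hm => ?_
  have h₁ := MDP.MemoryUpdate.eq_totalReward_of_weight_ne_zero hc m₀ w n m hm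
  rw [exMDP_totalReward w n h0 hw, hn] at h₁
  simpa only [Finset.mem_product, Finset.mem_univ, true_and, Finset.mem_singleton, level] using h₁

/-! ### An almost surely winning deterministic strategy, and the value. -/

open Classical in
/-- The deterministic strategy that moves from `s` to `r n` at time `n`. -/
noncomputable def timeStrategy : exMDP.Strategy where
  choice n h := if h ⟨n, Finset.mem_Iic.2 le_rfl⟩ = s then PMF.pure (r n) else PMF.pure s
  choice_support w n _ hc a ha := by
    change a ∈ (if w n = s then PMF.pure (r n) else PMF.pure s).support at ha
    have hc' : w n = s ∨ w n = t := hc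
    rcases hc' with h | h
    · rw [h] at ha ⊢
      simp only [if_true, PMF.support_pure, Set.mem_singleton_iff] at ha
      exact ha ▸ Trans.s_r n
    · rw [h] at ha ⊢
      simp only [reduceCtorEq, if_false, PMF.support_pure, Set.mem_singleton_iff] at ha
      exact ha ▸ Trans.t_s

theorem timeStrategy_isDeterministic : timeStrategy.IsDeterministic := by
  intro w n _ _
  by_cases h : w n = s
  exacts [⟨_, if_pos h⟩, ⟨_, if_neg h⟩]

theorem timeStrategy_next_s {n : ℕ} {w : ℕ → ExState} (h : w n = s) :
    timeStrategy.next n (Preorder.frestrictLe n w) = PMF.pure (r n) := by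
  rw [timeStrategy.next_of_mem (by rw [h]; simp [exMDP])]
  exact if_pos h

theorem timeStrategy_next_t {n : ℕ} {w : ℕ → ExState} (h : w n = t) :
    timeStrategy.next n (Preorder.frestrictLe n w) = PMF.pure s := by
  rw [timeStrategy.next_of_mem (by rw [h]; simp [exMDP])]
  exact if_neg (by simp [h])

/-- `t` is entered only from a random state. If that state is occupied at time `n`, it was chosen at
time `n - 1`, so it is `r (n - 1)`, with chance `2⁻¹ ^ n` of moving to `t`. At time `0` the run is
in `s`. -/
theorem measure_timeStrategy_eq_t (n : ℕ) :
    exMDP.runMeasure s timeStrategy {w | w (n + 1) = t} ≤ 2⁻¹ ^ n := by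
  classical
  have htm : MeasurableSet {w : ℕ → ExState | w (n + 1) = t} :=
    measurableSet_eq_t (n + 1)
  have h := MDP.lintegral_runMeasure_succ s timeStrategy n fun _ a => if a = t then 1 else 0
  calc _ = ∫⁻ w, {w : ℕ → ExState | w (n + 1) = t}.indicator 1 w
          ∂exMDP.runMeasure s timeStrategy := (lintegral_indicator_one htm).symm
    _ = ∫⁻ w, (if w (n + 1) = t then 1 else 0) ∂exMDP.runMeasure s timeStrategy := rfl
    _ ≤ ∫⁻ _, 2⁻¹ ^ n ∂exMDP.runMeasure s timeStrategy := by
        rw [h]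
        refine lintegral_mono_ae ?_
        filter_upwards [MDP.ae_runMeasure_zero s timeStrategy,
          MDP.ae_next_ne_zero s timeStrategy, ae_trans timeStrategy] with w h0 hnext ht
        simp only [mul_ite, mul_one, mul_zero, tsum_ite_eq]
        cases hn : w n with
        | s => simp [timeStrategy_next_s hn]
        | t => simp [timeStrategy_next_t hn]
        | r i =>
          rw [next_of_eq_r timeStrategy hn, leave_t]
          cases n with
          | zero => simp [h0] at hn
          | succ n =>
            have h₁ := ht n
            rw [hn] at h₁
            have h₂ : w n = s := by
              revert h₁
              generalize w n = x
              rintro (_ | _)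
              rfl
            have h₃ := hnext n
            rw [timeStrategy_next_s h₂, hn] at h₃
            have h₄ : i = n := by simpa [PMF.pure_apply] using h₃
            rw [h₄]
    _ = _ := by simp

theorem measure_pointPayoff_timeStrategy :
    exMDP.runMeasure s timeStrategy exMDP.pointPayoff = 1 := by
  have hsum : ∑' n, exMDP.runMeasure s timeStrategy {w | w (n + 1) = t} ≠ ∞ := by
    refine ne_top_of_le_ne_top ?_ (ENNReal.tsum_le_tsum measure_timeStrategy_eq_t)
    rw [ENNReal.tsum_geometric, ENNReal.one_sub_inv_two, inv_inv]
    simp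
  have h : ∀ᵐ w ∂exMDP.runMeasure s timeStrategy, w ∈ exMDP.pointPayoff := by
    -- Borel–Cantelli: almost surely only finitely many visits to `t` occur.
    filter_upwards [ae_eventually_notMem hsum, ae_trans timeStrategy] with w hw ht
    rw [mem_pointPayoff_iff ht]
    rw [← map_add_atTop_eq_nat 1, eventually_map]
    exact hw
  exact (measure_congr (eventuallyEq_univ.2 h)).trans measure_univ

theorem exMDP_value : exMDP.value exMDP.pointPayoff s = 1 :=
  le_antisymm (iSup_le fun _ => prob_le_one)
    (measure_pointPayoff_timeStrategy ▸ le_iSup (fun σ => exMDP.runMeasure s σ _) timeStrategy)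

/-- As the value is `1`, `σ` wins with probability at least `1 - ε > 0`, whereas both kinds of
memory give probability `0`. -/
theorem not_isFiniteMemory_of_isEpsOptimal {ε : ℝ} (hε : ε < 1) {σ : exMDP.Strategy}
    (h : exMDP.IsEpsOptimal exMDP.pointPayoff s ε σ) :
    ¬ σ.IsFiniteMemory s ∧ ¬ σ.IsFiniteMemoryRewardCounter s := by
  have hne : exMDP.runMeasure s σ exMDP.pointPayoff ≠ 0 := by
    rw [MDP.IsEpsOptimal, exMDP_value] at h
    refine ((tsub_pos_iff_lt.2 ?_).trans_le h).ne'
    rwa [ENNReal.ofReal_lt_one]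
  exact ⟨fun hf => hne (measure_pointPayoff_of_isFiniteMemory hf),
    fun hf => hne (measure_pointPayoff_of_isFiniteMemoryRewardCounter hf)⟩

theorem mainTheorem11 :
    exMDP.InfinitelyBranching ∧
    exMDP.RewardImplicit ExState.s ∧
    (∀ σ : exMDP.Strategy, σ.IsFiniteMemory ExState.s →
      exMDP.runMeasure ExState.s σ exMDP.pointPayoff = 0) ∧
    (∃ σ : exMDP.Strategy, σ.IsDeterministic ∧
      exMDP.runMeasure ExState.s σ exMDP.pointPayoff = 1) ∧
    exMDP.value exMDP.pointPayoff ExState.s = 1 ∧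
    (∀ ε : ℝ, 0 ≤ ε → ε < 1 → ∀ σ : exMDP.Strategy,
      exMDP.IsEpsOptimal exMDP.pointPayoff ExState.s ε σ →
      ¬ σ.IsFiniteMemory ExState.s ∧ ¬ σ.IsFiniteMemoryRewardCounter ExState.s) ∧
    (∀ σ : exMDP.Strategy, exMDP.IsOptimal exMDP.pointPayoff ExState.s σ →
      ¬ σ.IsFiniteMemory ExState.s ∧ ¬ σ.IsFiniteMemoryRewardCounter ExState.s) ∧
    (∀ σ : exMDP.Strategy, exMDP.IsAlmostSurelyWinning exMDP.pointPayoff ExState.s σ →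
      ¬ σ.IsFiniteMemory ExState.s ∧ ¬ σ.IsFiniteMemoryRewardCounter ExState.s) :=
  ⟨exMDP_infinitelyBranching, exMDP_rewardImplicit,
    fun _ => measure_pointPayoff_of_isFiniteMemory,
    ⟨timeStrategy, timeStrategy_isDeterministic, measure_pointPayoff_timeStrategy⟩,
    exMDP_value,
    fun _ _ hε _ => not_isFiniteMemory_of_isEpsOptimal hε,
    fun _ h => not_isFiniteMemory_of_isEpsOptimal one_pos h,
    fun _ h => not_isFiniteMemory_of_isEpsOptimal one_pos h.1⟩
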